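/- For a nontrivial bounded distributive lattice $D$ and $x\in D$ put $x^-:=1$ if $x=1$ and $x^-:=0$ otherwise, and let $\mathbf{2}=\{0,1\}$. Let $K(D)$ be the set of all $(x_0,x_1,x_2,x_3)\in\mathbf{2}\times D\times\mathbf{2}\times\mathbf{2}$ such that $x_i^-\wedge x_k^-\le x_j$ whenever $0\le i<j<k\le 3$ (the two elements of $\mathbf{2}$ being identified with the bounds of $D$), ordered componentwise; it is a closure system in $\mathbf{2}\times D\times\mathbf{2}\times\mathbf{2}$, hence a bounded lattice. Let $\mathcal{V}$ be the lattice variety generated by all lattices $K(B)$ for nontrivial Boolean lattices $B$, that is, the class of all lattices that satisfy every lattice identity valid in all these $K(B)$. Let $B_0$ be the Boolean lattice of all finite or cofinite subsets of $\omega$. A point of a lattice is an element $p$ such that the set of elements smaller than $p$ has a largest element; a lattice is spatial if each of its elements is a (possibly infinite) join of points, and algebraic if it is complete and each of its elements is a join of compact elements. Theorem. No algebraic spatial lattice in $\mathcal{V}$ contains (a copy of) $K(B_0)$ as a sublattice. Hence the bounded lattice $K(B_0)$ cannot be embedded within its variety into any algebraic spatial lattice; that is, there is no algebraic spatial lattice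 that belongs to the lattice variety generated by $K(B_0)$ and has a sublattice isomorphic to $K(B_0)$. -/

import Mathlib

universe u v w

namespace LatVar

/-! Lattice terms, identities and generated varieties. -/

/-- Lattice terms in countably many variables. -/
inductive Term : Type
  | var : ℕ → Term
  | join : Term → Term → Term
  | meet : Term → Term → Term

/-- The value of a lattice term under an assignment of the variables. -/
def Term.eval {L : Type u} [Lattice L] (e : ℕ → L) : Term → L
  | .var n => e n
  | .join s t => s.eval e ⊔ t.eval e
  | .meet s t => s.eval e ⊓ t.eval e

/-- The lattice `L` satisfies the identity `s = t`. -/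
def Satisfies (L : Type u) [Lattice L] (s t : Term) : Prop :=
  ∀ e : ℕ → L, s.eval e = t.eval e

/-- `L` belongs to the lattice variety generated by the class `𝒦` of lattices: it satisfies every
lattice identity that is valid in all members of `𝒦`. -/
def InVarietyGeneratedBy (𝒦 : (M : Type v) → [Lattice M] → Prop) (L : Type u) [Lattice L] :
    Prop :=
  ∀ s t : Term, (∀ (M : Type v) [Lattice M], 𝒦 M → Satisfies M s t) → Satisfies L s t

/-- `M` embeds into `L` as a sublattice (bounds need not be preserved). -/
def Embeds (M : Type v) [Lattice M] (L : Type u) [Lattice L] : Prop :=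
  ∃ f : LatticeHom M L, Function.Injective f

/-- `M` embeds into `L` within its variety: it is isomorphic to a sublattice of `L`, and `L` belongs
to the lattice variety generated by `M`. -/
def EmbedsWithinVariety (M : Type v) [Lattice M] (L : Type u) [Lattice L] : Prop :=
  Embeds M L ∧ InVarietyGeneratedBy (fun (N : Type v) [Lattice N] => Nonempty (N ≃o M)) L

/-! Points and spatial lattices. -/

/-- A point (completely join-irreducible element): there is a largest element below it. -/
def IsPoint {L : Type u} [Lattice L] (p : L) : Prop :=
  ∃ q : L, IsGreatest {x : L | x < p} q

/-- Every element is a join of points. -/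
def IsSpatial (L : Type u) [Lattice L] : Prop :=
  ∀ a : L, ∃ S : Set L, (∀ p ∈ S, IsPoint p) ∧ IsLUB S a

/-! The lattices `K(D)`. -/

section KLattice

variable (D : Type w) [DistribLattice D] [BoundedOrder D]

/-- The lattice `𝟐 × D × 𝟐 × 𝟐`, ordered componentwise. -/
abbrev Prod4 : Type w := Bool × D × Bool × Bool

variable {D}

/-- The two-element lattice seen inside `D`. -/
def ofTwo (b : Bool) : D := if b then ⊤ else ⊥

/-- The four coordinates, all of them seen in `D`. -/
def coord (x : Prod4 D) : Fin 4 → D :=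
  ![ofTwo x.1, x.2.1, ofTwo x.2.2.1, ofTwo x.2.2.2]

open Classical in
/-- `x⁻` is `1` if `x = 1`, and `0` otherwise. -/
noncomputable def minus (x : D) : D := if x = ⊤ then ⊤ else ⊥

/-- `x_i⁻ ∧ x_k⁻ ≤ x_j` for all `i < j < k`. -/
def MemK (x : Prod4 D) : Prop :=
  ∀ i j k : Fin 4, i < j → j < k → minus (coord x i) ⊓ minus (coord x k) ≤ coord x j

variable (D) in
/-- The set `K(D)`. -/
def K : Type w := {x : Prod4 D // MemK x}

/-- `K(D)` is ordered componentwise. -/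
instance : PartialOrder (K D) := inferInstanceAs (PartialOrder {x : Prod4 D // MemK x})

theorem minus_le (x : D) : minus x ≤ x := by
  unfold minus; split_ifs with h
  · exact h.ge
  · exact bot_le

theorem minus_ofTwo (b : Bool) : minus (ofTwo b : D) = ofTwo b := by
  apply le_antisymm (minus_le _)
  cases b <;> simp [ofTwo, minus]

theorem ofTwo_mono {a b : Bool} (h : a ≤ b) : (ofTwo a : D) ≤ ofTwo b := by
  revert h; cases a <;> cases b <;> simp [ofTwo]

theorem minus_mono {x y : D} (h : x ≤ y) : minus x ≤ minus y := by
  unfold minus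
  split_ifs with h1 h2
  · exact le_rfl
  · exact absurd (top_le_iff.mp (h1 ▸ h)) h2
  · exact bot_le
  · exact le_rfl

theorem coord_mono {x y : Prod4 D} (h : x ≤ y) (i : Fin 4) : coord x i ≤ coord y i := by
  obtain ⟨h0, h1, h2, h3⟩ := h
  fin_cases i
  · exact ofTwo_mono h0
  · exact h1
  · exact ofTwo_mono h2
  · exact ofTwo_mono h3

theorem ofTwo_inf (a b : Bool) : (ofTwo (a ⊓ b) : D) = ofTwo a ⊓ ofTwo b := by
  cases a <;> cases b <;> simp [ofTwo]

theorem coord_inf (x y : Prod4 D) (i : Fin 4) : coord (x ⊓ y) i = coord x i ⊓ coord y i := by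
  fin_cases i
  · exact ofTwo_inf _ _
  · rfl
  · exact ofTwo_inf _ _
  · exact ofTwo_inf _ _

theorem memK_inf {x y : Prod4 D} (hx : MemK x) (hy : MemK y) : MemK (x ⊓ y) := by
  intro i j k hij hjk
  rw [coord_inf x y j]
  exact le_inf
    ((inf_le_inf (minus_mono (coord_mono inf_le_left i))
      (minus_mono (coord_mono inf_le_left k))).trans (hx i j k hij hjk))
    ((inf_le_inf (minus_mono (coord_mono inf_le_right i))
      (minus_mono (coord_mono inf_le_right k))).trans (hy i j k hij hjk))

open Classical in
/-- The closure map `γ`: `γ(x)_j` is the join of `x_j` and all `x_i⁻ ∧ x_k⁻` with `i < j < k`. -/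
noncomputable def gamma (x : Prod4 D) : Prod4 D :=
  (x.1,
   x.2.1 ⊔ (ofTwo (x.1 ⊓ x.2.2.1) ⊔ ofTwo (x.1 ⊓ x.2.2.2)),
   x.2.2.1 ⊔ ((x.1 ⊓ x.2.2.2) ⊔ (decide (x.2.1 = ⊤) ⊓ x.2.2.2)),
   x.2.2.2)

theorem le_gamma (x : Prod4 D) : x ≤ gamma x :=
  ⟨le_rfl, le_sup_left, le_sup_left, le_rfl⟩

theorem memK_iff [Nontrivial D] (x : Prod4 D) :
    MemK x ↔ (x.1 = true → x.2.2.1 = true → x.2.1 = ⊤) ∧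
      (x.1 = true → x.2.2.2 = true → x.2.1 = ⊤) ∧
      (x.1 = true → x.2.2.2 = true → x.2.2.1 = true) ∧
      (x.2.1 = ⊤ → x.2.2.2 = true → x.2.2.1 = true) := by
  have h4 : MemK x ↔ (minus (ofTwo x.1) ⊓ minus (ofTwo x.2.2.1) ≤ x.2.1) ∧
      (minus (ofTwo x.1) ⊓ minus (ofTwo x.2.2.2) ≤ x.2.1) ∧
      (minus (ofTwo x.1) ⊓ minus (ofTwo x.2.2.2) ≤ (ofTwo x.2.2.1 : D)) ∧
      (minus x.2.1 ⊓ minus (ofTwo x.2.2.2) ≤ (ofTwo x.2.2.1 : D)) := by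
    constructor
    · intro h
      exact ⟨h 0 1 2 (by decide) (by decide), h 0 1 3 (by decide) (by decide),
        h 0 2 3 (by decide) (by decide), h 1 2 3 (by decide) (by decide)⟩
    · rintro ⟨h1, h2, h3, h5⟩ i j k hij hjk
      fin_cases i <;> fin_cases j <;> fin_cases k <;>
        first
          | exact absurd hij (by decide)
          | exact absurd hjk (by decide)
          | assumption
  rw [h4]
  simp only [minus_ofTwo]
  obtain ⟨a, d, b, c⟩ := x
  by_cases hd : d = ⊤ <;> cases a <;> cases b <;> cases c <;> simp [ofTwo, minus, hd]

theorem memK_gamma [Nontrivial D] (x : Prod4 D) : MemK (gamma x) := by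
  rw [memK_iff]
  obtain ⟨a, d, b, c⟩ := x
  by_cases hd : d = ⊤ <;> cases a <;> cases b <;> cases c <;> simp [gamma, ofTwo, hd]

theorem gamma_le [Nontrivial D] {x y : Prod4 D} (hxy : x ≤ y) (hy : MemK y) : gamma x ≤ y := by
  classical
  obtain ⟨k1, k2, k3, k4⟩ := (memK_iff y).mp hy
  obtain ⟨h0, h1, h2, h3⟩ := hxy
  have key : x.2.1 = ⊤ → y.2.1 = ⊤ := fun h => top_le_iff.mp (h ▸ h1)
  have g0 : x.1 = true → y.1 = true := h0
  have g2 : x.2.2.1 = true → y.2.2.1 = true := h2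
  have g3 : x.2.2.2 = true → y.2.2.2 = true := h3
  refine ⟨h0, sup_le h1 (sup_le ?_ ?_), sup_le h2 (sup_le ?_ ?_), h3⟩
  · by_cases h : x.1 = true ∧ x.2.2.1 = true
    · rw [k1 (g0 h.1) (g2 h.2)]; exact le_top
    · have : (x.1 ⊓ x.2.2.1) = false := by
        rw [← Bool.not_eq_true]; simpa using h
      rw [this]; exact bot_le
  · by_cases h : x.1 = true ∧ x.2.2.2 = true
    · rw [k2 (g0 h.1) (g3 h.2)]; exact le_top
    · have : (x.1 ⊓ x.2.2.2) = false := by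
        rw [← Bool.not_eq_true]; simpa using h
      rw [this]; exact bot_le
  · change (x.1 && x.2.2.2) = true → y.2.2.1 = true
    intro h
    rw [Bool.and_eq_true] at h
    exact k3 (g0 h.1) (g3 h.2)
  · change (decide (x.2.1 = ⊤) && x.2.2.2) = true → y.2.2.1 = true
    intro h
    rw [Bool.and_eq_true, decide_eq_true_eq] at h
    exact k4 (key h.1) (g3 h.2)

/-- `K(D)` is a lattice: meets are componentwise, and the join of two elements is the least element
of `K(D)` above their componentwise join. -/
noncomputable instance [Nontrivial D] : Lattice (K D) where
  sup x y := ⟨gamma (x.1 ⊔ y.1), memK_gamma _⟩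
  le_sup_left x y := le_sup_left.trans (le_gamma (x.1 ⊔ y.1))
  le_sup_right x y := le_sup_right.trans (le_gamma (x.1 ⊔ y.1))
  sup_le _ _ z hx hy := gamma_le (sup_le hx hy) z.2
  inf x y := ⟨x.1 ⊓ y.1, memK_inf x.2 y.2⟩
  inf_le_left x y := (inf_le_left : x.1 ⊓ y.1 ≤ x.1)
  inf_le_right x y := (inf_le_right : x.1 ⊓ y.1 ≤ y.1)
  le_inf x y z hxy hxz := (le_inf hxy hxz : x.1 ≤ y.1 ⊓ z.1)

end KLattice

/-- The class of all lattices (isomorphic to one) of the form `K(B)`, for a nontrivial Boolean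
lattice `B`. -/
def IsKBoolean (M : Type v) [Lattice M] : Prop :=
  ∃ (B : Type v) (_ : BooleanAlgebra B) (_ : Nontrivial B), Nonempty (M ≃o K B)

/-- The Boolean lattice of all subsets of `ω` that are either finite or cofinite. -/
def B₀ : BooleanSubalgebra (Set ℕ) where
  carrier := {s | s.Finite ∨ sᶜ.Finite}
  supClosed' := by
    rintro s hs t ht
    simp only [Set.mem_ofPred_eq, Set.sup_eq_union, Set.compl_union, Set.finite_union] at hs ht ⊢
    rcases hs with hs | hs
    · rcases ht with ht | ht
      · exact Or.inl ⟨hs, ht⟩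
      · exact Or.inr (ht.subset Set.inter_subset_right)
    · exact Or.inr (hs.subset Set.inter_subset_left)
  infClosed' := by
    rintro s hs t ht
    simp only [Set.mem_ofPred_eq, Set.inf_eq_inter, Set.compl_inter, Set.finite_union] at hs ht ⊢
    rcases hs with hs | hs
    · exact Or.inl (hs.subset Set.inter_subset_left)
    · rcases ht with ht | ht
      · exact Or.inl (ht.subset Set.inter_subset_right)
      · exact Or.inr ⟨hs, ht⟩
  compl_mem' := by
    intro s hs
    simpa [or_comm] using hs
  bot_mem' := Or.inl Set.finite_empty

instance : Nontrivial B₀ :=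
  ⟨⊥, ⊤, fun h => Set.empty_ne_univ (congrArg Subtype.val h)⟩

end LatVar

/-!
The proof rests on one lattice identity (`DoubleCover`), valid in every `K(D)`: with
`m = ⋁ x_i ∧ y_j`,
`w ∧ (x₀ ∨ x₁) ∧ (y₀ ∨ y₁) ≤ ⋁ w ∧ (z ∨ m)`, where `z` ranges over `x₀, x₁, y₀, y₁`.

Write `a`, `u_d`, `b`, `c` for the elements of `K(D)` concentrated on one of the four coordinates.
Then `u_1 ≤ a ∨ b` and `u_1 = u_d ∨ u_{¬d}`, while `a` and `b` meet `u_d` and `u_{¬d}` in the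
bottom element. Hence in a lattice that satisfies the identity and contains `K(D)`, each
join-irreducible element below `u_1` lies below `u_d` or below `u_{¬d}`
(`DoubleCover.le_or_le_compl`).

Let now such a lattice be algebraic and spatial, and let `D` be a Boolean lattice with an infinite
sequence of disjoint nonzero elements `e_k`. Some point `p ≤ b` is not below the bottom of `K(D)`.
Points are compact, so from `p ≤ b ≤ u_1 ∨ c` it follows that `p ≤ q_1 ∨ ⋯ ∨ q_n ∨ c` for finitely
many points `q_i ≤ u_1`. Since the `e_k` are disjoint, there is a `k` for which every `q_i` lies
below `u_{¬e_k}`. Then `p ≤ b ∧ (u_{¬e_k} ∨ c)`, which is the bottom of `K(D)`, a contradiction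
(`DoubleCover.not_embeds`).
-/

namespace LatVar

/-- A weakening of the distributive law: the part of `w` covered both by `{x₀, x₁}` and by
`{y₀, y₁}` lies below the join of the meets of `w` with the members of the two coverings, once each
member is enlarged by the join `m` of all the `xᵢ ⊓ yⱼ`. -/
def DoubleCover (L : Type u) [Lattice L] : Prop :=
  ∀ w x₀ x₁ y₀ y₁ m : L, m = x₀ ⊓ y₀ ⊔ x₀ ⊓ y₁ ⊔ (x₁ ⊓ y₀ ⊔ x₁ ⊓ y₁) →
    w ⊓ ((x₀ ⊔ x₁) ⊓ (y₀ ⊔ y₁)) ≤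
      w ⊓ (x₀ ⊔ m) ⊔ w ⊓ (x₁ ⊔ m) ⊔ (w ⊓ (y₀ ⊔ m) ⊔ w ⊓ (y₁ ⊔ m))

/-- `DoubleCover` is expressible by a lattice identity, so it passes to generated varieties. -/
theorem InVarietyGeneratedBy.doubleCover {𝒦 : (M : Type v) → [Lattice M] → Prop}
    (h𝒦 : ∀ (M : Type v) [Lattice M], 𝒦 M → DoubleCover M) {L : Type u} [Lattice L]
    (hL : InVarietyGeneratedBy 𝒦 L) : DoubleCover L := by
  let m : Term := .join (.join (.meet (.var 1) (.var 3)) (.meet (.var 1) (.var 4)))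
    (.join (.meet (.var 2) (.var 3)) (.meet (.var 2) (.var 4)))
  let lhs : Term := .meet (.var 0) (.meet (.join (.var 1) (.var 2)) (.join (.var 3) (.var 4)))
  let part (i : ℕ) : Term := .meet (.var 0) (.join (.var i) m)
  let rhs : Term := .join (.join (part 1) (part 2)) (.join (part 3) (part 4))
  have key := hL (.meet lhs rhs) lhs fun M _ hM e =>
    inf_eq_left.2 (h𝒦 M hM (e 0) (e 1) (e 2) (e 3) (e 4) _ rfl)
  rintro w x₀ x₁ y₀ y₁ _ rfl
  exact inf_eq_left.1 (key fun n => match n with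
    | 0 => w | 1 => x₀ | 2 => x₁ | 3 => y₀ | _ => y₁)

theorem DoubleCover.of_orderIso {M : Type u} {N : Type v} [Lattice M] [Lattice N] (f : M ≃o N)
    (hN : DoubleCover N) : DoubleCover M := by
  rintro w x₀ x₁ y₀ y₁ _ rfl
  rw [← f.le_iff_le]
  simpa only [map_sup, map_inf] using hN (f w) (f x₀) (f x₁) (f y₀) (f y₁) _ rfl

/-! ### The identity in `K(D)` -/

namespace K

variable {D : Type w} [DistribLattice D] [BoundedOrder D]

theorem le_iff {x y : K D} : x ≤ y ↔ (x.1.1 = true → y.1.1 = true) ∧ x.1.2.1 ≤ y.1.2.1 ∧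
    (x.1.2.2.1 = true → y.1.2.2.1 = true) ∧ (x.1.2.2.2 = true → y.1.2.2.2 = true) :=
  Iff.rfl

variable [Nontrivial D]

theorem inf_zero {x y : K D} : (x ⊓ y).1.1 = true ↔ x.1.1 = true ∧ y.1.1 = true := by
  change (x.1.1 && y.1.1) = true ↔ _
  simp

theorem inf_one {x y : K D} : (x ⊓ y).1.2.1 = x.1.2.1 ⊓ y.1.2.1 := rfl

theorem inf_two {x y : K D} :
    (x ⊓ y).1.2.2.1 = true ↔ x.1.2.2.1 = true ∧ y.1.2.2.1 = true := by
  change (x.1.2.2.1 && y.1.2.2.1) = true ↔ _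
  simp

theorem inf_three {x y : K D} :
    (x ⊓ y).1.2.2.2 = true ↔ x.1.2.2.2 = true ∧ y.1.2.2.2 = true := by
  change (x.1.2.2.2 && y.1.2.2.2) = true ↔ _
  simp

theorem sup_zero {x y : K D} : (x ⊔ y).1.1 = true ↔ x.1.1 = true ∨ y.1.1 = true := by
  change (x.1.1 || y.1.1) = true ↔ _
  simp

theorem sup_three {x y : K D} :
    (x ⊔ y).1.2.2.2 = true ↔ x.1.2.2.2 = true ∨ y.1.2.2.2 = true := by
  change (x.1.2.2.2 || y.1.2.2.2) = true ↔ _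
  simp

theorem sup_two {x y : K D} : (x ⊔ y).1.2.2.1 = true ↔
    (x.1.2.2.1 = true ∨ y.1.2.2.1 = true) ∨
      (((x.1.1 = true ∨ y.1.1 = true) ∨ x.1.2.1 ⊔ y.1.2.1 = ⊤) ∧
        (x.1.2.2.2 = true ∨ y.1.2.2.2 = true)) := by
  classical
  change ((x.1.2.2.1 || y.1.2.2.1) || (((x.1.1 || y.1.1) && (x.1.2.2.2 || y.1.2.2.2)) ||
    (@decide (x.1.2.1 ⊔ y.1.2.1 = ⊤) (Classical.propDecidable _) &&
      (x.1.2.2.2 || y.1.2.2.2)))) = true ↔ _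
  simp only [Bool.or_eq_true, Bool.and_eq_true, decide_eq_true_eq]
  tauto

theorem sup_one_le {x y : K D} : x.1.2.1 ⊔ y.1.2.1 ≤ (x ⊔ y).1.2.1 := le_sup_left

theorem sup_one_of_top {x y : K D} (h₀ : x.1.1 = true ∨ y.1.1 = true)
    (h : (x.1.2.2.1 = true ∨ y.1.2.2.1 = true) ∨ (x.1.2.2.2 = true ∨ y.1.2.2.2 = true)) :
    (x ⊔ y).1.2.1 = ⊤ := by
  have hm := (memK_iff (x ⊔ y).1).1 (x ⊔ y).2
  rcases h with h | h
  · exact hm.1 (sup_zero.2 h₀) (sup_two.2 (.inl h))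
  · exact hm.2.1 (sup_zero.2 h₀) (sup_three.2 h)

theorem sup_one_of_not {x y : K D} (h : ¬((x.1.1 = true ∨ y.1.1 = true) ∧
    ((x.1.2.2.1 = true ∨ y.1.2.2.1 = true) ∨ (x.1.2.2.2 = true ∨ y.1.2.2.2 = true)))) :
    (x ⊔ y).1.2.1 = x.1.2.1 ⊔ y.1.2.1 := by
  have h₂ : ((x.1.1 || y.1.1) && (x.1.2.2.1 || y.1.2.2.1)) = false := by
    rw [← Bool.not_eq_true]; simp only [Bool.or_eq_true, Bool.and_eq_true]; tauto
  have h₃ : ((x.1.1 || y.1.1) && (x.1.2.2.2 || y.1.2.2.2)) = false := by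
    rw [← Bool.not_eq_true]; simp only [Bool.or_eq_true, Bool.and_eq_true]; tauto
  change x.1.2.1 ⊔ y.1.2.1 ⊔ (ofTwo ((x.1.1 || y.1.1) && (x.1.2.2.1 || y.1.2.2.1)) ⊔
    ofTwo ((x.1.1 || y.1.1) && (x.1.2.2.2 || y.1.2.2.2))) = _
  rw [h₂, h₃]
  simp [ofTwo]

/-- Coordinates `0` and `3` are join-prime, coordinate `1` is nontrivially covered only with the help
of coordinate `0`, and coordinate `2` only with the help of coordinate `3`. If both coverings are
nontrivial, then `m` contains the coordinate that helps them. -/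
theorem doubleCover : DoubleCover (K D) := by
  intro w x₀ x₁ y₀ y₁ m hm
  have m₀ : m.1.1 = true ↔
      (x₀.1.1 = true ∨ x₁.1.1 = true) ∧ (y₀.1.1 = true ∨ y₁.1.1 = true) := by
    simp only [hm, sup_zero, inf_zero]; tauto
  have m₃ : m.1.2.2.2 = true ↔
      (x₀.1.2.2.2 = true ∨ x₁.1.2.2.2 = true) ∧ (y₀.1.2.2.2 = true ∨ y₁.1.2.2.2 = true) := by
    simp only [hm, sup_three, inf_three]; tauto
  have m₁ : (x₀.1.2.1 ⊔ x₁.1.2.1) ⊓ (y₀.1.2.1 ⊔ y₁.1.2.1) ≤ m.1.2.1 := by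
    rw [hm, inf_sup_left, inf_sup_right, inf_sup_right]
    refine le_trans ?_ sup_one_le
    refine le_trans (le_of_eq ?_) (sup_le_sup sup_one_le sup_one_le)
    simp only [inf_one]
    ac_rfl
  clear hm
  obtain ⟨R, hR⟩ : ∃ R, R = w ⊓ (x₀ ⊔ m) ⊔ w ⊓ (x₁ ⊔ m) ⊔ (w ⊓ (y₀ ⊔ m) ⊔ w ⊓ (y₁ ⊔ m)) := ⟨_, rfl⟩
  have r₀ : w ⊓ (x₀ ⊔ m) ≤ R := hR ▸ le_sup_left.trans le_sup_left
  have r₁ : w ⊓ (x₁ ⊔ m) ≤ R := hR ▸ le_sup_right.trans le_sup_left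
  have r₂ : w ⊓ (y₀ ⊔ m) ≤ R := hR ▸ le_sup_left.trans le_sup_right
  have r₃ : w ⊓ (y₁ ⊔ m) ≤ R := hR ▸ le_sup_right.trans le_sup_right
  rw [← hR]
  clear hR
  rw [le_iff] at r₀ r₁ r₂ r₃ ⊢
  refine ⟨?_, ?_, ?_, ?_⟩
  · intro h
    obtain ⟨hw, h⟩ := inf_zero.1 h
    rcases sup_zero.1 (inf_zero.1 h).1 with h | h
    · exact r₀.1 (inf_zero.2 ⟨hw, sup_zero.2 (.inl h)⟩)
    · exact r₁.1 (inf_zero.2 ⟨hw, sup_zero.2 (.inl h)⟩)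
  · replace r₀ := r₀.2.1
    replace r₁ := r₁.2.1
    replace r₂ := r₂.2.1
    replace r₃ := r₃.2.1
    simp only [inf_one] at r₀ r₁ r₂ r₃ ⊢
    by_cases hx : (x₀.1.1 = true ∨ x₁.1.1 = true) ∧
      ((x₀.1.2.2.1 = true ∨ x₁.1.2.2.1 = true) ∨ (x₀.1.2.2.2 = true ∨ x₁.1.2.2.2 = true))
    · by_cases hy : (y₀.1.1 = true ∨ y₁.1.1 = true) ∧
        ((y₀.1.2.2.1 = true ∨ y₁.1.2.2.1 = true) ∨ (y₀.1.2.2.2 = true ∨ y₁.1.2.2.2 = true))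
      · refine inf_le_left.trans ?_
        have hm₀ := m₀.2 ⟨hx.1, hy.1⟩
        have top : (x₀ ⊔ m).1.2.1 = ⊤ ∨ (x₁ ⊔ m).1.2.1 = ⊤ := by
          rcases hx.2 with (h | h) | (h | h)
          · exact .inl (sup_one_of_top (.inr hm₀) (.inl (.inl h)))
          · exact .inr (sup_one_of_top (.inr hm₀) (.inl (.inl h)))
          · exact .inl (sup_one_of_top (.inr hm₀) (.inr (.inl h)))
          · exact .inr (sup_one_of_top (.inr hm₀) (.inr (.inl h)))
        rcases top with h | h
        · simpa only [h, inf_top_eq] using r₀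
        · simpa only [h, inf_top_eq] using r₁
      · rw [sup_one_of_not hy]
        refine (inf_le_inf_left _ inf_le_right).trans ?_
        rw [inf_sup_left]
        exact sup_le ((inf_le_inf_left _ (le_sup_left.trans sup_one_le)).trans r₂)
          ((inf_le_inf_left _ (le_sup_left.trans sup_one_le)).trans r₃)
    · rw [sup_one_of_not hx]
      refine (inf_le_inf_left _ inf_le_left).trans ?_
      rw [inf_sup_left]
      exact sup_le ((inf_le_inf_left _ (le_sup_left.trans sup_one_le)).trans r₀)
        ((inf_le_inf_left _ (le_sup_left.trans sup_one_le)).trans r₁)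
  · intro h
    obtain ⟨hw, h⟩ := inf_two.1 h
    obtain ⟨hx, hy⟩ := inf_two.1 h
    replace r₀ (h) := r₀.2.2.1 (inf_two.2 ⟨hw, sup_two.2 h⟩)
    replace r₁ (h) := r₁.2.2.1 (inf_two.2 ⟨hw, sup_two.2 h⟩)
    replace r₂ (h) := r₂.2.2.1 (inf_two.2 ⟨hw, sup_two.2 h⟩)
    replace r₃ (h) := r₃.2.2.1 (inf_two.2 ⟨hw, sup_two.2 h⟩)
    rcases sup_two.1 hx with (h | h) | ⟨hx, hx₃⟩
    · exact r₀ (.inl (.inl h))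
    · exact r₁ (.inl (.inl h))
    rcases sup_two.1 hy with (h | h) | ⟨hy, hy₃⟩
    · exact r₂ (.inl (.inl h))
    · exact r₃ (.inl (.inl h))
    have hm₃ := m₃.2 ⟨hx₃, hy₃⟩
    rcases hx with (h | h) | hx
    · exact r₀ (.inr ⟨.inl (.inl h), .inr hm₃⟩)
    · exact r₁ (.inr ⟨.inl (.inl h), .inr hm₃⟩)
    rcases hy with (h | h) | hy
    · exact r₂ (.inr ⟨.inl (.inl h), .inr hm₃⟩)
    · exact r₃ (.inr ⟨.inl (.inl h), .inr hm₃⟩)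
    -- Both coverings are nontrivial because of coordinate `1`, so `m` is `⊤` there.
    rw [hx, hy, inf_top_eq, top_le_iff] at m₁
    exact r₀ (.inr ⟨.inr (by rw [m₁, sup_top_eq]), .inr hm₃⟩)
  · intro h
    obtain ⟨hw, h⟩ := inf_three.1 h
    rcases sup_three.1 (inf_three.1 h).1 with h | h
    · exact r₀.2.2.2 (inf_three.2 ⟨hw, sup_three.2 (.inl h)⟩)
    · exact r₁.2.2.2 (inf_three.2 ⟨hw, sup_three.2 (.inl h)⟩)

/-! ### Elements of `K(D)` with one nonzero coordinate -/

variable (D) in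
/-- The element of `K(D)` concentrated on coordinate `0`. -/
def a : K D := ⟨(true, ⊥, false, false), (memK_iff _).2 (by simp)⟩

/-- The element of `K(D)` concentrated on coordinate `1`, with value `d` there. -/
def u (d : D) : K D := ⟨(false, d, false, false), (memK_iff _).2 (by simp)⟩

variable (D) in
/-- The element of `K(D)` concentrated on coordinate `2`. -/
def b : K D := ⟨(false, ⊥, true, false), (memK_iff _).2 (by simp)⟩

variable (D) in
/-- The element of `K(D)` concentrated on coordinate `3`. -/
def c : K D := ⟨(false, ⊥, false, true), (memK_iff _).2 (by simp)⟩

theorem u_bot_le (x : K D) : u ⊥ ≤ x := le_iff.2 ⟨nofun, bot_le, nofun, nofun⟩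

theorem u_inf_of_disjoint {d e : D} (h : Disjoint d e) : u d ⊓ u e = u ⊥ :=
  (u_bot_le _).antisymm' (le_iff.2 ⟨id, h.le_bot, id, id⟩)

theorem a_inf_u (d : D) : a D ⊓ u d = u ⊥ :=
  (u_bot_le _).antisymm' (le_iff.2 ⟨nofun, inf_le_left, nofun, nofun⟩)

theorem b_inf_u (d : D) : b D ⊓ u d = u ⊥ :=
  (u_bot_le _).antisymm' (le_iff.2 ⟨nofun, inf_le_left, nofun, nofun⟩)

theorem u_le_u_sup_u {d e : D} (h : Codisjoint d e) (f : D) : u f ≤ u d ⊔ u e :=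
  le_iff.2 ⟨nofun, (le_top.trans h.top_le).trans (sup_one_le (x := u d) (y := u e)), nofun, nofun⟩

theorem u_le_a_sup_b (d : D) : u d ≤ a D ⊔ b D :=
  le_iff.2 ⟨nofun, (sup_one_of_top (x := a D) (y := b D) (.inl rfl) (.inl (.inr rfl))).symm ▸ le_top,
    nofun, nofun⟩

theorem b_le_u_top_sup_c : b D ≤ u ⊤ ⊔ c D :=
  le_iff.2 ⟨nofun, bot_le, fun _ => sup_two.2 (.inr ⟨.inr (top_sup_eq _), .inr rfl⟩), nofun⟩

theorem not_b_le_u_bot : ¬ b D ≤ u ⊥ := fun h => nomatch (le_iff.1 h).2.2.1 rfl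

theorem b_inf_u_sup_c {d : D} (hd : d ≠ ⊤) : b D ⊓ (u d ⊔ c D) = u ⊥ := by
  refine (u_bot_le _).antisymm' (le_iff.2 ⟨nofun, inf_le_left, fun h => ?_, nofun⟩)
  have h := sup_two.1 (inf_two.1 h).2
  simp [u, c, hd] at h

end K

/-! ### Algebraic spatial lattices -/

theorem IsPoint.le_or_le {L : Type u} [Lattice L] {p x y : L} (hp : IsPoint p)
    (h : p = x ⊔ y) : p ≤ x ∨ p ≤ y := by
  obtain ⟨q, hq, hmax⟩ := hp
  by_contra! hn
  have hx : x < p := lt_of_le_of_ne (h ▸ le_sup_left) fun e => hn.1 e.ge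
  have hy : y < p := lt_of_le_of_ne (h ▸ le_sup_right) fun e => hn.2 e.ge
  exact (h.le.trans (sup_le (hmax hx) (hmax hy))).not_gt hq

theorem IsPoint.isCompactElement {L : Type u} [CompleteLattice L] [IsCompactlyGenerated L] {p : L}
    (hp : IsPoint p) : IsCompactElement p := by
  obtain ⟨q, hq, hmax⟩ := hp
  obtain ⟨s, hs, rfl⟩ := IsCompactlyGenerated.exists_sSup_eq p
  by_cases h : sSup s ∈ s
  · exact hs _ h
  · exact absurd hq (sSup_le fun x hx => hmax
      (lt_of_le_of_ne (le_sSup hx) fun e => h (e ▸ hx))).not_gt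

/-- As `f (u ⊤)` has the covering `{f a, f b}`, whose members meet each `f (u d)` in `f (u ⊥)`, the
inequality for this covering and `{f (u d), f (u dᶜ)}` reduces to distributivity. -/
theorem DoubleCover.le_or_le_compl {L : Type u} [Lattice L] (hL : DoubleCover L)
    {B : Type w} [BooleanAlgebra B] [Nontrivial B] (f : LatticeHom (K B) L) {q : L}
    (hq : IsPoint q) (hqu : q ≤ f (K.u ⊤)) (d : B) : q ≤ f (K.u d) ∨ q ≤ f (K.u dᶜ) := by
  have bot_le (x : K B) : f (K.u ⊥) ≤ f x := OrderHomClass.mono f (K.u_bot_le x)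
  have ha (d : B) : f (K.a B) ⊓ f (K.u d) = f (K.u ⊥) := by rw [← map_inf, K.a_inf_u]
  have hb (d : B) : f (K.b B) ⊓ f (K.u d) = f (K.u ⊥) := by rw [← map_inf, K.b_inf_u]
  have hab : q ≤ f (K.a B) ⊔ f (K.b B) := by
    rw [← map_sup]; exact hqu.trans (OrderHomClass.mono f (K.u_le_a_sup_b ⊤))
  have hdd : q ≤ f (K.u d) ⊔ f (K.u dᶜ) := by
    rw [← map_sup]
    exact hqu.trans (OrderHomClass.mono f (K.u_le_u_sup_u isCompl_compl.codisjoint ⊤))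
  have key := hL q _ _ _ _ (f (K.u ⊥)) (by simp only [ha, hb, sup_idem])
    |>.trans' (le_inf le_rfl (le_inf hab hdd))
  simp only [sup_eq_left.2 (bot_le _)] at key
  have hqa : q ⊓ f (K.a B) ≤ f (K.u ⊥) :=
    (le_inf inf_le_right (inf_le_left.trans hqu)).trans (ha ⊤).le
  have hqb : q ⊓ f (K.b B) ≤ f (K.u ⊥) :=
    (le_inf inf_le_right (inf_le_left.trans hqu)).trans (hb ⊤).le
  rcases hq.le_or_le (key.antisymm (by simp)) with h | h
  · exact .inl (h.trans ((sup_le hqa hqb).trans (bot_le _)))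
  · exact (hq.le_or_le (le_antisymm h (by simp))).imp (·.trans inf_le_right) (·.trans inf_le_right)

theorem DoubleCover.not_embeds {L : Type u} [CompleteLattice L] [IsCompactlyGenerated L]
    (hL : DoubleCover L) (hs : IsSpatial L) {B : Type w} [BooleanAlgebra B] [Nontrivial B]
    (e : ℕ → B) (he : ∀ k, e k ≠ ⊥) (hd : Pairwise fun k l => Disjoint (e k) (e l)) : ¬ Embeds (K B) L := by
  rintro ⟨f, hf⟩
  have mono : Monotone f := OrderHomClass.mono f
  have hbot : ¬ f (K.b B) ≤ f (K.u ⊥) := fun h =>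
    K.not_b_le_u_bot (inf_eq_left.1 (hf (by rw [map_inf, inf_eq_left.2 h])))
  obtain ⟨S, hS, hSb⟩ := hs (f (K.b B))
  obtain ⟨p, hpS, hp⟩ : ∃ p ∈ S, ¬ p ≤ f (K.u ⊥) := by
    by_contra! h
    exact hbot (hSb.2 h)
  obtain ⟨T, hT, hTu⟩ := hs (f (K.u ⊤))
  have hpT : p ≤ sSup (insert (f (K.c B)) T) := by
    rw [sSup_insert, hTu.sSup_eq, sup_comm, ← map_sup]
    exact (hSb.1 hpS).trans (mono K.b_le_u_top_sup_c)
  obtain ⟨F, hF, hpF⟩ := (CompleteLattice.isCompactElement_iff_exists_le_sSup_of_le_sSup _ p).1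
    (hS p hpS).isCompactElement _ hpT
  -- A member of `F` not below `u (e k)ᶜ ⊔ c` lies below `u (e k)`; as the `e k` are disjoint, this
  -- happens for at most one `k`.
  obtain ⟨k, hk⟩ : ∃ k, ∀ q ∈ F, q ≤ f (K.u (e k)ᶜ) ⊔ f (K.c B) := by
    by_contra! h
    choose g hgF hg using h
    obtain ⟨k, l, hkl, hgkl⟩ :=
      Finite.exists_ne_map_eq_of_infinite fun k => (⟨g k, hgF k⟩ : F)
    replace hgkl : g k = g l := congrArg Subtype.val hgkl
    have below (k) : g k ≤ f (K.u (e k)) := by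
      rcases hF (hgF k) with h | h
      · exact absurd (h.le.trans le_sup_right) (hg k)
      · exact (hL.le_or_le_compl f (hT _ h) (hTu.1 h) (e k)).resolve_right
          fun h => hg k (h.trans le_sup_left)
    have hgbot : g k ≤ f (K.u (e k)) ⊓ f (K.u (e l)) := le_inf (below k) (hgkl ▸ below l)
    rw [← map_inf, K.u_inf_of_disjoint (hd hkl)] at hgbot
    exact hg k ((hgbot.trans (mono (K.u_bot_le _))).trans le_sup_left)
  have hpk : p ≤ f (K.b B) ⊓ (f (K.u (e k)ᶜ) ⊔ f (K.c B)) :=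
    le_inf (hSb.1 hpS) (hpF.trans (Finset.sup_le hk))
  rw [← map_sup, ← map_inf, K.b_inf_u_sup_c (by simpa using he k)] at hpk
  exact hp hpk

/-- The disjoint nonzero elements of `B₀` used here are the singletons. -/
theorem DoubleCover.not_embeds_B₀ {L : Type u} [CompleteLattice L] [IsCompactlyGenerated L]
    (hL : DoubleCover L) (hs : IsSpatial L) : ¬ Embeds (K B₀) L := by
  refine hL.not_embeds hs (fun k => (⟨{k}, .inl (Set.finite_singleton k)⟩ : B₀)) (fun k h => ?_)
    fun k l hkl => ?_
  · exact Set.singleton_ne_empty k (congrArg Subtype.val h)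
  · refine disjoint_iff.2 (Subtype.ext ?_)
    exact (Set.disjoint_singleton.2 hkl).inter_eq

end LatVar

theorem theoremT :
    -- No algebraic spatial lattice in the variety generated by all `K(B)` contains `K(B₀)`.
    (∀ (L : Type u) [CompleteLattice L] [IsCompactlyGenerated L],
      LatVar.IsSpatial L →
      LatVar.InVarietyGeneratedBy.{u, v} (fun M [Lattice M] => LatVar.IsKBoolean M) L →
      ¬ LatVar.Embeds (LatVar.K LatVar.B₀) L) ∧
    -- `K(B₀)` is a bounded lattice.
    ((∃ a : LatVar.K LatVar.B₀, IsBot a) ∧ (∃ b : LatVar.K LatVar.B₀, IsTop b)) ∧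
    -- `K(B₀)` embeds, within its variety, into no algebraic spatial lattice.
    (∀ (L : Type u) [CompleteLattice L] [IsCompactlyGenerated L],
      LatVar.IsSpatial L →
      ¬ LatVar.EmbedsWithinVariety (LatVar.K LatVar.B₀) L) := by
  refine ⟨fun L _ _ hs hv => ?_, ⟨⟨LatVar.K.u ⊥, LatVar.K.u_bot_le⟩, ?_⟩, fun L _ _ hs h => ?_⟩
  · refine (hv.doubleCover fun M _ hM => ?_).not_embeds_B₀ hs
    obtain ⟨B, _, _, ⟨g⟩⟩ := hM
    exact LatVar.K.doubleCover.of_orderIso g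
  · exact ⟨⟨(true, ⊤, true, true), (LatVar.memK_iff _).2 (by simp)⟩,
      fun x => LatVar.K.le_iff.2 ⟨fun _ => rfl, le_top, fun _ => rfl, fun _ => rfl⟩⟩
  · refine (h.2.doubleCover fun M _ hM => ?_).not_embeds_B₀ hs h.1
    obtain ⟨g⟩ := hM
    exact LatVar.K.doubleCover.of_orderIso g
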